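/- For $1\le\nu<\infty$ let $\mathcal F^\nu$ be the Fock space of entire functions $f$ on $\mathbb C$ with \[ \|f\|_\nu=\Big(\frac{\nu}{2\pi}\int_{\mathbb C}|f(z)|^\nu e^{-\nu|z|^2/2}\,dm(z)\Big)^{1/\nu}<\infty , \] where $m$ is Lebesgue area measure; for $\nu=2$ it carries the inner product $\frac1\pi\int_{\mathbb C} \overline{f(z)}\,g(z)\,e^{-|z|^2}\,dm(z)$, which induces the norm. For an entire function $\phi$ write $C_\phi f=f\circ\phi$. 1. Let $\phi(z)=az$ with $|a|=1$ and $a\neq1$. Then $C_\phi$ is a bounded operator on $\mathcal F^\nu$, every iterate $C_\phi^n$ ($n\ge 0$) is unitary, i.e. a surjective linear isometry of $\mathcal F^\nu$ (and, for $\nu=2$, a surjective operator preserving the inner product), and $(C_\phi^n)_n$ does not converge even weakly: there is no bounded operator $P$ on $\mathcal F^\nu$ such that $C_\phi^nf\to Pf$ weakly for all $f\in\mathcal F^\nu$. 2. Let $\phi(z)=az+b$ with $a,b\in\mathbb C$ and $|a|<1$. Then $C_\phi$ is a bounded operator on $\mathcal F^\nu$, and $C_\phi^n$ converges in operator norm to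 the bounded rank-one operator $T$ that maps $f$ to the constant function with value $f\big(\tfrac{b}{1-a}\big)$. -/

import Mathlib

open MeasureTheory Filter Topology ComplexConjugate

namespace FockSpace

noncomputable section

/-- The Gaussian weight `exp (-ν |z|² / 2)` on `ℂ`. -/
def weight (ν : ℝ) (z : ℂ) : ℝ := Real.exp (-ν * ‖z‖ ^ 2 / 2)

/-- The measure `(ν / 2π) exp (-ν |z|² / 2) dm(z)` on `ℂ`, with `m` the Lebesgue area measure. -/
def gaussMeasure (ν : ℝ) : Measure ℂ :=
  (volume : Measure ℂ).withDensity fun z => ENNReal.ofReal (ν / (2 * Real.pi) * weight ν z)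

/-- The functional `(ν / 2π ∫ |f(z)| ^ ν exp (-ν |z|² / 2) dm(z)) ^ (1 / ν)`. -/
def fockNorm (ν : ℝ) (f : ℂ → ℂ) : ℝ :=
  (ν / (2 * Real.pi) * ∫ z : ℂ, ‖f z‖ ^ ν * weight ν z) ^ (1 / ν)

theorem weight_pos (ν : ℝ) (z : ℂ) : 0 < weight ν z := Real.exp_pos _

theorem continuous_weight (ν : ℝ) : Continuous (weight ν) := by
  unfold weight; fun_prop

theorem density_pos {ν : ℝ} (hν : 1 ≤ ν) (z : ℂ) : 0 < ν / (2 * Real.pi) * weight ν z := by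
  have := weight_pos ν z
  have := Real.pi_pos
  positivity

theorem measurable_density (ν : ℝ) :
    Measurable fun z => ENNReal.ofReal (ν / (2 * Real.pi) * weight ν z) :=
  ((continuous_weight ν).const_mul _ |>.measurable).ennreal_ofReal

theorem volume_absolutelyContinuous {ν : ℝ} (hν : 1 ≤ ν) :
    (volume : Measure ℂ) ≪ gaussMeasure ν :=
  withDensity_absolutelyContinuous' (measurable_density ν).aemeasurable
    (ae_of_all _ fun z => by simpa using density_pos hν z)

theorem integrable_gaussMeasure_iff {ν : ℝ} (hν : 1 ≤ ν) (g : ℂ → ℝ) :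
    Integrable g (gaussMeasure ν) ↔ Integrable (fun z => g z * weight ν z) := by
  rw [gaussMeasure, integrable_withDensity_iff (measurable_density ν)
    (ae_of_all _ fun z => ENNReal.ofReal_lt_top)]
  have hc : ν / (2 * Real.pi) ≠ 0 := by
    have := Real.pi_pos
    positivity
  have : (fun z => g z * (ENNReal.ofReal (ν / (2 * Real.pi) * weight ν z)).toReal)
      = fun z => (ν / (2 * Real.pi)) * (g z * weight ν z) := by
    ext z
    rw [ENNReal.toReal_ofReal (density_pos hν z).le]
    ring
  rw [this]
  exact integrable_const_mul_iff (IsUnit.mk0 _ hc) _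

theorem integral_gaussMeasure {ν : ℝ} (hν : 1 ≤ ν) (g : ℂ → ℝ) :
    ∫ z, g z ∂(gaussMeasure ν) = ν / (2 * Real.pi) * ∫ z, g z * weight ν z := by
  rw [gaussMeasure, integral_withDensity_eq_integral_toReal_smul (measurable_density ν)
    (ae_of_all _ fun z => ENNReal.ofReal_lt_top), ← integral_const_mul]
  congr 1
  ext z
  rw [ENNReal.toReal_ofReal (density_pos hν z).le, smul_eq_mul]
  ring

theorem memLp_iff {ν : ℝ} (hν : 1 ≤ ν) {f : ℂ → ℂ} (hf : Continuous f) :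
    MemLp f (ENNReal.ofReal ν) (gaussMeasure ν) ↔
      Integrable (fun z => ‖f z‖ ^ ν * weight ν z) := by
  rw [← integrable_gaussMeasure_iff hν, ← integrable_norm_rpow_iff hf.aestronglyMeasurable
    (by simp; linarith) ENNReal.ofReal_ne_top, ENNReal.toReal_ofReal (by linarith)]

theorem fockNorm_eq {ν : ℝ} (hν : 1 ≤ ν) {f : ℂ → ℂ}
    (hf : MemLp f (ENNReal.ofReal ν) (gaussMeasure ν)) :
    fockNorm ν f = (eLpNorm f (ENNReal.ofReal ν) (gaussMeasure ν)).toReal := by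
  rw [hf.eLpNorm_eq_integral_rpow_norm (by simp; linarith) ENNReal.ofReal_ne_top,
    ENNReal.toReal_ofReal (by positivity), ENNReal.toReal_ofReal (by linarith),
    integral_gaussMeasure hν, fockNorm, one_div]

/-- The entire functions `f` for which `|f(z)| ^ ν exp (-ν |z|² / 2)` is integrable,
as a vector space. -/
def fockSubmodule (ν : ℝ) [hν : Fact (1 ≤ ν)] : Submodule ℂ (ℂ → ℂ) where
  carrier := {f | Differentiable ℂ f ∧ Integrable fun z => ‖f z‖ ^ ν * weight ν z}
  add_mem' := by
    rintro f g ⟨hf, hf'⟩ ⟨hg, hg'⟩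
    refine ⟨hf.add hg, ?_⟩
    rw [← memLp_iff hν.out hf.continuous] at hf'
    rw [← memLp_iff hν.out hg.continuous] at hg'
    exact (memLp_iff hν.out (hf.add hg).continuous).1 (hf'.add hg')
  zero_mem' := by
    refine ⟨differentiable_const 0, ?_⟩
    exact (memLp_iff hν.out continuous_zero).1 MemLp.zero
  smul_mem' := by
    rintro c f ⟨hf, hf'⟩
    refine ⟨hf.const_smul c, ?_⟩
    rw [← memLp_iff hν.out hf.continuous] at hf'
    exact (memLp_iff hν.out (hf.const_smul c).continuous).1 (hf'.const_smul c)

end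

end FockSpace

/-- The Fock space `𝓕^ν`, `1 ≤ ν < ∞`. It is a type of its own, so that its topology is that of the
Fock norm and not that of pointwise convergence. -/
def Fock (ν : ℝ) [Fact (1 ≤ ν)] : Type := FockSpace.fockSubmodule ν

namespace Fock

open FockSpace

noncomputable section

variable {ν : ℝ} [hν : Fact (1 ≤ ν)]

instance : AddCommGroup (Fock ν) := inferInstanceAs (AddCommGroup (fockSubmodule ν))

instance : Module ℂ (Fock ν) := inferInstanceAs (Module ℂ (fockSubmodule ν))

instance : CoeFun (Fock ν) (fun _ => ℂ → ℂ) := ⟨fun f => f.1⟩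

theorem ext {f g : Fock ν} (h : ∀ z, f z = g z) : f = g := Subtype.ext (funext h)

theorem differentiable (f : Fock ν) : Differentiable ℂ f := f.2.1

theorem integrable (f : Fock ν) : Integrable fun z => ‖f z‖ ^ ν * weight ν z := f.2.2

theorem memLp (f : Fock ν) : MemLp f (ENNReal.ofReal ν) (gaussMeasure ν) :=
  (memLp_iff hν.out f.differentiable.continuous).2 f.integrable

@[simp] theorem coe_zero : ((0 : Fock ν) : ℂ → ℂ) = 0 := rfl

@[simp] theorem coe_add (f g : Fock ν) : ((f + g : Fock ν) : ℂ → ℂ) = f + g := rfl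

@[simp] theorem coe_neg (f : Fock ν) : ((-f : Fock ν) : ℂ → ℂ) = -f := rfl

@[simp] theorem coe_smul (c : ℂ) (f : Fock ν) : ((c • f : Fock ν) : ℂ → ℂ) = c • (f : ℂ → ℂ) := rfl

instance : NormedAddCommGroup (Fock ν) :=
  AddGroupNorm.toNormedAddCommGroup
    { toFun := fun f => fockNorm ν f
      map_zero' := by
        rw [fockNorm_eq hν.out (memLp 0)]
        simp
      add_le' := fun f g => by
        rw [fockNorm_eq hν.out (memLp _), fockNorm_eq hν.out (memLp _),
          fockNorm_eq hν.out (memLp _),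
          ← ENNReal.toReal_add (memLp f).eLpNorm_ne_top (memLp g).eLpNorm_ne_top]
        refine ENNReal.toReal_mono
          (ENNReal.add_ne_top.2 ⟨(memLp f).eLpNorm_ne_top, (memLp g).eLpNorm_ne_top⟩) ?_
        exact eLpNorm_add_le (memLp f).1 (memLp g).1 (by simpa using hν.out)
      neg' := fun f => by
        simp [fockNorm]
      eq_zero_of_map_eq_zero' := fun f hf => by
        have h0 : fockNorm ν f = 0 := hf
        rw [fockNorm_eq hν.out (memLp _), ENNReal.toReal_eq_zero_iff] at h0
        have h1 := h0.resolve_right (memLp f).eLpNorm_ne_top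
        rw [eLpNorm_eq_zero_iff (memLp f).1 (by simp; linarith [hν.out])] at h1
        have h2 : (f : ℂ → ℂ) =ᵐ[volume] 0 := (volume_absolutelyContinuous hν.out).ae_le h1
        have h3 := (Continuous.ae_eq_iff_eq volume f.differentiable.continuous
          continuous_zero).1 h2
        exact Fock.ext fun z => congrFun h3 z }

theorem norm_def (f : Fock ν) : ‖f‖ = (ν / (2 * Real.pi) *
    ∫ z : ℂ, ‖f z‖ ^ ν * Real.exp (-ν * ‖z‖ ^ 2 / 2)) ^ (1 / ν) := rfl

theorem norm_eq (f : Fock ν) :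
    ‖f‖ = (eLpNorm f (ENNReal.ofReal ν) (gaussMeasure ν)).toReal :=
  fockNorm_eq hν.out (memLp f)

instance : NormedSpace ℂ (Fock ν) where
  norm_smul_le c f := by
    rw [norm_eq, norm_eq, coe_smul, eLpNorm_const_smul, ENNReal.toReal_mul, toReal_enorm]

instance fact_one_le_two : Fact ((1 : ℝ) ≤ 2) := ⟨one_le_two⟩

theorem integrable_conj_mul (f g : Fock 2) :
    Integrable fun z : ℂ => conj (f z) * g z * (Real.exp (-‖z‖ ^ 2) : ℂ) := by
  have hf := f.integrable
  have hg := g.integrable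
  refine (hf.add hg).mono' ?_ (ae_of_all _ fun z => ?_)
  · have h1 := f.differentiable.continuous
    have h2 := g.differentiable.continuous
    refine Continuous.aestronglyMeasurable ?_
    fun_prop
  · have hw : weight 2 z = Real.exp (-‖z‖ ^ 2) := by
      unfold weight; congr 1; ring
    have he := Real.exp_pos (-‖z‖ ^ 2)
    simp only [Pi.add_apply, hw, norm_mul, RCLike.norm_conj, Complex.norm_real, Real.rpow_ofNat,
      Real.norm_eq_abs, abs_of_pos he]
    nlinarith [mul_nonneg he.le (sq_nonneg (‖f z‖ - ‖g z‖)),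
      mul_nonneg he.le (sq_nonneg (‖f z‖)), mul_nonneg he.le (sq_nonneg (‖g z‖))]

/-- The inner product `(1 / π) ∫ conj (f(z)) g(z) exp (-|z|²) dm(z)` of `𝓕²` (linear in the second
variable), whose norm is the Fock norm. -/
instance : InnerProductSpace ℂ (Fock 2) where
  inner f g := (1 / Real.pi : ℂ) * ∫ z : ℂ, conj (f z) * g z * (Real.exp (-‖z‖ ^ 2) : ℂ)
  norm_sq_eq_re_inner f := by
    have h1 : (fun z : ℂ => conj (f z) * f z * (Real.exp (-‖z‖ ^ 2) : ℂ))
        = fun z : ℂ => ((‖f z‖ ^ (2 : ℝ) * weight 2 z : ℝ) : ℂ) := by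
      ext z
      have hw : weight 2 z = Real.exp (-‖z‖ ^ 2) := by
        unfold weight; congr 1; ring
      rw [hw, Complex.conj_mul']
      simp
    have h2 : 0 ≤ ∫ z : ℂ, ‖f z‖ ^ (2 : ℝ) * weight 2 z :=
      integral_nonneg fun z => mul_nonneg (by positivity) (weight_pos 2 z).le
    have h3 : ‖f‖ = fockNorm 2 f := rfl
    have hp := Real.pi_pos
    rw [h1, integral_complex_ofReal, h3, fockNorm, ← Real.sqrt_eq_rpow, Real.sq_sqrt (by positivity)]
    have h4 : ((1 : ℂ) / Real.pi) * ((∫ z : ℂ, ‖f z‖ ^ (2 : ℝ) * weight 2 z : ℝ) : ℂ)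
        = ((1 / Real.pi * ∫ z : ℂ, ‖f z‖ ^ (2 : ℝ) * weight 2 z : ℝ) : ℂ) := by
      push_cast; ring
    rw [h4]
    simp only [RCLike.re_to_complex, Complex.ofReal_re]
    congr 1
    field_simp
  conj_inner_symm f g := by
    rw [map_mul, ← integral_conj]
    congr 1
    · simp
    · congr 1
      ext z
      simp only [map_mul, Complex.conj_conj, Complex.conj_ofReal]
      ring
  add_left f g h := by
    rw [← mul_add, ← integral_add (integrable_conj_mul f h) (integrable_conj_mul g h)]
    congr 2
    funext z
    simp only [coe_add, Pi.add_apply, map_add]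
    ring
  smul_left f g c := by
    rw [mul_left_comm, ← integral_const_mul (conj c)]
    congr 2
    funext z
    simp only [coe_smul, Pi.smul_apply, smul_eq_mul, map_mul]
    ring

theorem inner_def (f g : Fock 2) : inner ℂ f g =
    (1 / Real.pi : ℂ) * ∫ z : ℂ, conj (f z) * g z * (Real.exp (-‖z‖ ^ 2) : ℂ) := rfl

/-- `C` is the composition operator `f ↦ f ∘ φ`, as a bounded operator on `𝓕^ν`. -/
def IsCompositionOperator (φ : ℂ → ℂ) (C : Fock ν →L[ℂ] Fock ν) : Prop :=
  ∀ (f : Fock ν) (z : ℂ), C f z = f (φ z)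

end

end Fock

/-!
Rotations preserve both the area measure and the Gaussian weight, so composition with `z ↦ a z`,
`|a| = 1`, is isometric, and composition with `z ↦ a⁻¹ z` inverts it. The coordinate function is an
eigenvector with eigenvalue `a`. A functional that does not vanish on it would turn weak convergence
of the powers into convergence of `a ^ n`, which forces `a = 1`.

For `φ(z) = a z + b` with `|a| < 1` everything rests on a pointwise bound
`|f(w)| ≤ K exp ((|w| + 1)² / 2) ‖f‖` (`Fock.exists_norm_apply_le`), obtained from the mean value
property on the unit disc about `w`, Hölder's inequality and the size of the weight on that disc.
Since `φ` contracts, the bound for `f ∘ φ` grows at a Gaussian rate strictly below that of the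
weight, and this alone gives boundedness (`FockSpace.fockNorm_le_of_growth`); no change of variables
is made. With Cauchy's estimate the pointwise bound becomes a local Lipschitz bound
(`Fock.exists_norm_sub_le`). The iterates are `φⁿ(z) = p + aⁿ (z - p)` with `p = b / (1 - a)`, so
`|f(φⁿ(z)) - f(p)|` is at most `|a|ⁿ ‖f‖` times a function that does not depend on `n ≥ 1` and again
grows strictly slower than `exp (|z|² / 2)`. Hence `‖C_φⁿ - T‖ ≤ M |a|ⁿ`
(`Fock.IsCompositionOperator.exists_norm_pow_sub_le`).
-/

namespace FockSpace

/-! ### Growth conditions that imply membership -/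

theorem weight_mul_exp_rpow (ν s M : ℝ) (hM : 0 ≤ M) (z : ℂ) :
    (M * Real.exp (s * ‖z‖ ^ 2 / 2)) ^ ν * weight ν z
      = M ^ ν * Real.exp (-(ν * (1 - s) / 2) * ‖z‖ ^ 2) := by
  rw [Real.mul_rpow hM (Real.exp_pos _).le, ← Real.exp_mul, weight, mul_assoc, ← Real.exp_add]
  congr 2
  ring

theorem integrable_exp_neg_mul_norm_sq {c : ℝ} (hc : 0 < c) :
    Integrable fun z : ℂ => Real.exp (-c * ‖z‖ ^ 2) := by
  have h := (GaussianFourier.integrable_cexp_neg_mul_sq_norm_add (V := ℂ) (b := c)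
    (by simpa using hc) 0 0).norm
  refine h.congr (ae_of_all _ fun z => ?_)
  simp only [Complex.norm_exp]
  congr 1
  have : (-(c : ℂ) * (‖z‖ : ℂ) ^ 2) = ((-c * ‖z‖ ^ 2 : ℝ) : ℂ) := by push_cast; ring
  simp only [zero_mul, add_zero]
  rw [this, Complex.ofReal_re]

/-- A function growing strictly slower than `exp (|z|² / 2)` lies in the Fock space, with a norm
controlled by the growth constant. -/
theorem fockNorm_le_of_growth {ν : ℝ} (hν : 1 ≤ ν) {s : ℝ} (hs : s < 1) :
    ∃ K : ℝ, 0 ≤ K ∧ ∀ (f : ℂ → ℂ) (M : ℝ), Continuous f → 0 ≤ M →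
      (∀ z, ‖f z‖ ≤ M * Real.exp (s * ‖z‖ ^ 2 / 2)) →
      Integrable (fun z => ‖f z‖ ^ ν * weight ν z) ∧ fockNorm ν f ≤ K * M := by
  have hν0 : 0 < ν := by linarith
  have hpi := Real.pi_pos
  set c := ν * (1 - s) / 2 with hc
  have hc0 : 0 < c := by
    have : 0 < 1 - s := by linarith
    positivity
  have hint := integrable_exp_neg_mul_norm_sq hc0
  have hI : 0 ≤ ∫ z : ℂ, Real.exp (-c * ‖z‖ ^ 2) :=
    integral_nonneg fun z => (Real.exp_pos _).le
  refine ⟨(ν / (2 * Real.pi) * ∫ z : ℂ, Real.exp (-c * ‖z‖ ^ 2)) ^ (1 / ν), by positivity, ?_⟩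
  intro f M hf hM hfM
  have hle : ∀ z, ‖f z‖ ^ ν * weight ν z ≤ M ^ ν * Real.exp (-c * ‖z‖ ^ 2) := fun z => by
    rw [hc, ← weight_mul_exp_rpow ν s M hM z]
    have := weight_pos ν z
    gcongr
    exact hfM z
  have hnn : ∀ z, 0 ≤ ‖f z‖ ^ ν * weight ν z := fun z => by
    have := weight_pos ν z
    positivity
  have hfi : Integrable (fun z => ‖f z‖ ^ ν * weight ν z) := by
    refine (hint.const_mul (M ^ ν)).mono' ?_ (ae_of_all _ fun z => ?_)
    · exact ((hf.norm.rpow_const fun _ => Or.inr hν0.le).mul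
        (continuous_weight ν)).aestronglyMeasurable
    · rw [Real.norm_of_nonneg (hnn z)]
      exact hle z
  refine ⟨hfi, ?_⟩
  have h1 : ∫ z, ‖f z‖ ^ ν * weight ν z ≤ M ^ ν * ∫ z : ℂ, Real.exp (-c * ‖z‖ ^ 2) := by
    rw [← integral_const_mul]
    exact integral_mono hfi (hint.const_mul _) hle
  have h0 : 0 ≤ ∫ z, ‖f z‖ ^ ν * weight ν z := integral_nonneg hnn
  calc fockNorm ν f
      ≤ (ν / (2 * Real.pi) * (M ^ ν * ∫ z : ℂ, Real.exp (-c * ‖z‖ ^ 2))) ^ (1 / ν) := by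
        unfold fockNorm
        gcongr
    _ = _ := by
        rw [mul_left_comm, Real.mul_rpow (by positivity) (by positivity), ← Real.rpow_mul hM,
          mul_one_div_cancel hν0.ne', Real.rpow_one, mul_comm]

/-- A polynomial factor and an affine change of the variable are absorbed by a Gaussian of rate
`s < 1`, provided that the variable is contracted. -/
theorem exists_linear_mul_exp_le {r : ℝ} (hr0 : 0 ≤ r) (hr : r < 1) (c : ℝ) :
    ∃ s A : ℝ, s < 1 ∧ 0 ≤ A ∧ ∀ t : ℝ, 0 ≤ t →
      (1 + t) * Real.exp ((c + r * t) ^ 2 / 2) ≤ A * Real.exp (s * t ^ 2 / 2) := by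
  have hd : 0 < 1 - r ^ 2 := by nlinarith
  set d := 1 - r ^ 2 with hd'
  -- `s = (1 + r²) / 2`; the constant completes the square in the difference of the exponents
  refine ⟨(1 + r ^ 2) / 2, Real.exp (c ^ 2 / 2 + (1 + r * c) ^ 2 / d), by linarith,
    (Real.exp_pos _).le, fun t ht => ?_⟩
  have h1 : 1 + t ≤ Real.exp t := by linarith [Real.add_one_le_exp t]
  refine (mul_le_mul_of_nonneg_right h1 (Real.exp_pos _).le).trans ?_
  rw [← Real.exp_add, ← Real.exp_add]
  refine Real.exp_le_exp.2 ?_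
  have h2 : c ^ 2 / 2 + (1 + r * c) ^ 2 / d + (1 + r ^ 2) / 2 * t ^ 2 / 2 -
      (t + (c + r * t) ^ 2 / 2) = (d * t / 2 - (1 + r * c)) ^ 2 / d := by
    have hr2 : r ^ 2 = 1 - d := by rw [hd']; ring
    rw [eq_div_iff hd.ne']
    field_simp
    ring_nf
    rw [hr2]
    ring
  have h3 : 0 ≤ (d * t / 2 - (1 + r * c)) ^ 2 / d := by positivity
  linarith

/-! ### Local comparison with Lebesgue measure -/

/-- Sub-mean value property of `‖f‖` on discs, for `f` entire. The disc integral is averaged over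
all rotations about the centre, and the mean value property on circles is used under the integral
sign, so that no radial integration is needed. -/
theorem volume_ball_mul_enorm_le {f : ℂ → ℂ} (hf : Differentiable ℂ f) (w : ℂ) :
    volume (Metric.ball (0 : ℂ) 1) * ‖f w‖ₑ ≤ ∫⁻ u in Metric.ball (0 : ℂ) 1, ‖f (w + u)‖ₑ := by
  have hpi := Real.pi_pos
  set B := Metric.ball (0 : ℂ) 1
  set J := Set.Ioc (0 : ℝ) (2 * Real.pi)
  have hJ : volume J = ENNReal.ofReal (2 * Real.pi) := by simp [J]
  have hJ0 : volume J ≠ 0 := by rw [hJ]; simpa using hpi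
  have hJt : volume J ≠ ⊤ := by rw [hJ]; exact ENNReal.ofReal_ne_top
  have hcirc : ∀ u : ℂ, volume J * ‖f w‖ₑ
      ≤ ∫⁻ θ in J, ‖f (w + Complex.exp (θ * Complex.I) * u)‖ₑ := by
    intro u
    -- the mean value property of `z ↦ f (w + z * u)` on the unit circle
    have h2 : ∫ θ in J, f (w + Complex.exp (θ * Complex.I) * u) = (2 * Real.pi : ℝ) • f w := by
      have hg : Differentiable ℂ fun z => f (w + z * u) := by fun_prop
      have h3 : Real.circleAverage (fun z => f (w + z * u)) 0 1 = f (w + 0 * u) :=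
        DiffContOnCl.circleAverage hg.diffContOnCl
      rw [Real.circleAverage, intervalIntegral.integral_of_le (by positivity)] at h3
      simp only [circleMap, zero_mul, add_zero, zero_add, Complex.ofReal_one, one_mul] at h3
      rw [← h3, smul_smul, mul_inv_cancel₀ (by positivity), one_smul]
    have h4 := enorm_integral_le_lintegral_enorm (μ := volume.restrict J)
      fun θ : ℝ => f (w + Complex.exp (θ * Complex.I) * u)
    rw [h2, enorm_smul] at h4
    rwa [hJ, ← Real.enorm_of_nonneg (by positivity)]
  have hrot : ∀ θ : ℝ, ∫⁻ u in B, ‖f (w + Complex.exp (θ * Complex.I) * u)‖ₑ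
      = ∫⁻ u in B, ‖f (w + u)‖ₑ := by
    intro θ
    have hmp := (rotation (Circle.exp θ)).measurePreserving
    have hpre : rotation (Circle.exp θ) ⁻¹' B = B := by
      ext u
      simp only [B, Set.mem_preimage, mem_ball_zero_iff, LinearIsometryEquiv.norm_map]
    have h := hmp.setLIntegral_comp_preimage_emb
      (rotation (Circle.exp θ)).toHomeomorph.measurableEmbedding (fun u => ‖f (w + u)‖ₑ) B
    rw [hpre] at h
    simpa [rotation_apply, Circle.coe_exp] using h
  have hmeas : Measurable fun q : ℂ × ℝ => ‖f (w + Complex.exp (q.2 * Complex.I) * q.1)‖ₑ := by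
    have := hf.continuous
    exact Continuous.measurable (by fun_prop)
  have key : volume J * (volume B * ‖f w‖ₑ) ≤ volume J * ∫⁻ u in B, ‖f (w + u)‖ₑ := by
    calc volume J * (volume B * ‖f w‖ₑ) = ∫⁻ _ in B, volume J * ‖f w‖ₑ := by
          rw [setLIntegral_const]; ring
      _ ≤ ∫⁻ u in B, ∫⁻ θ in J, ‖f (w + Complex.exp (θ * Complex.I) * u)‖ₑ :=
          lintegral_mono fun u => hcirc u
      _ = ∫⁻ θ in J, ∫⁻ u in B, ‖f (w + Complex.exp (θ * Complex.I) * u)‖ₑ :=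
          lintegral_lintegral_swap hmeas.aemeasurable
      _ = volume J * ∫⁻ u in B, ‖f (w + u)‖ₑ := by
          simp_rw [hrot]
          rw [setLIntegral_const, mul_comm]
  exact (ENNReal.mul_le_mul_iff_right hJ0 hJt).1 key

/-- On the unit disc about `w` the weight is at least `exp (-ν (|w| + 1)² / 2)`, so Lebesgue measure
is dominated there by a multiple of the Gaussian measure. -/
theorem restrict_ball_le_gaussMeasure {ν : ℝ} (hν : 1 ≤ ν) (w : ℂ) :
    (volume : Measure ℂ).restrict (Metric.ball w 1) ≤
      ENNReal.ofReal (2 * Real.pi / ν * Real.exp (ν * (‖w‖ + 1) ^ 2 / 2)) • gaussMeasure ν := by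
  have hν0 : 0 < ν := by linarith
  have hpi := Real.pi_pos
  refine Measure.le_iff.2 fun s hs => ?_
  rw [Measure.smul_apply, gaussMeasure, withDensity_apply _ hs, smul_eq_mul,
    ← lintegral_const_mul _ (measurable_density ν), Measure.restrict_apply hs,
    ← setLIntegral_one]
  refine (setLIntegral_mono' (hs.inter Metric.isOpen_ball.measurableSet) ?_).trans
    (lintegral_mono_set Set.inter_subset_left)
  rintro z ⟨-, hz⟩
  rw [← ENNReal.ofReal_mul (by positivity), ENNReal.one_le_ofReal]
  have hz' : ‖z‖ ≤ ‖w‖ + 1 := by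
    have h1 : ‖z - w‖ < 1 := by simpa [dist_eq_norm] using hz
    have h2 := norm_sub_norm_le z w
    linarith
  have : 2 * Real.pi / ν * Real.exp (ν * (‖w‖ + 1) ^ 2 / 2) * (ν / (2 * Real.pi) * weight ν z)
      = Real.exp (ν * (‖w‖ + 1) ^ 2 / 2 + -ν * ‖z‖ ^ 2 / 2) := by
    rw [weight, Real.exp_add]
    field_simp
  rw [this]
  refine Real.one_le_exp ?_
  have h3 : ‖z‖ ^ 2 ≤ (‖w‖ + 1) ^ 2 := by gcongr
  nlinarith

end FockSpace

namespace Fock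

open FockSpace

variable {ν : ℝ} [hν : Fact (1 ≤ ν)]

/-! ### Bounds on point evaluations -/

/-- Point evaluations are bounded on the Fock space, with a bound that is almost of the optimal
order `exp (|w|² / 2)`. -/
theorem exists_norm_apply_le (ν : ℝ) [hν : Fact (1 ≤ ν)] : ∃ K : ℝ, 0 ≤ K ∧
    ∀ (f : Fock ν) (w : ℂ), ‖f w‖ ≤ K * Real.exp ((‖w‖ + 1) ^ 2 / 2) * ‖f‖ := by
  have hν1 := hν.out
  have hν0 : 0 < ν := by linarith
  have hpi := Real.pi_pos
  set V := volume (Metric.ball (0 : ℂ) 1) with hV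
  have hV0 : V ≠ 0 := (Metric.measure_ball_pos volume 0 one_pos).ne'
  have hVt : V ≠ ⊤ := measure_ball_lt_top.ne
  -- the constant in Hölder's inequality between the `L¹` and `L^ν` norms on the unit disc
  set H := (V ^ (1 / (1 : ENNReal).toReal - 1 / (ENNReal.ofReal ν).toReal)) with hH
  have hHt : H ≠ ⊤ := by
    rw [hH]
    exact (ENNReal.rpow_lt_top_of_nonneg (by
      rw [ENNReal.toReal_one, ENNReal.toReal_ofReal hν0.le, sub_nonneg]
      gcongr) hVt).ne
  refine ⟨H.toReal * (2 * Real.pi / ν) ^ (1 / ν) / V.toReal, by positivity, fun f w => ?_⟩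
  set c := 2 * Real.pi / ν * Real.exp (ν * (‖w‖ + 1) ^ 2 / 2) with hc
  have hc0 : 0 ≤ c := by positivity
  have hfc := f.differentiable.continuous
  have hL1 : ∫⁻ u in Metric.ball (0 : ℂ) 1, ‖f (w + u)‖ₑ
      = eLpNorm f 1 (volume.restrict (Metric.ball w 1)) := by
    have hmp := measurePreserving_add_left (volume : Measure ℂ) w
    have h := hmp.setLIntegral_comp_preimage_emb
      (Homeomorph.addLeft w).measurableEmbedding (fun u => ‖f u‖ₑ) (Metric.ball w 1)
    rw [eLpNorm_one_eq_lintegral_enorm, ← h]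
    congr 2
    ext u
    simp
  have hfin : (eLpNorm f (ENNReal.ofReal ν) (gaussMeasure ν)) ≠ ⊤ := (memLp f).eLpNorm_ne_top
  have hmain : V * ‖f w‖ₑ ≤ ENNReal.ofReal c ^ (1 / ν) *
      eLpNorm f (ENNReal.ofReal ν) (gaussMeasure ν) * H := by
    calc V * ‖f w‖ₑ ≤ eLpNorm f 1 (volume.restrict (Metric.ball w 1)) :=
          (volume_ball_mul_enorm_le f.differentiable w).trans_eq hL1
      _ ≤ eLpNorm f (ENNReal.ofReal ν) (volume.restrict (Metric.ball w 1)) * H := by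
          refine (eLpNorm_le_eLpNorm_mul_rpow_measure_univ (p := 1) (q := ENNReal.ofReal ν)
            (by simpa using hν1) hfc.aestronglyMeasurable).trans_eq ?_
          rw [Measure.restrict_apply_univ, Measure.addHaar_ball_center]
      _ ≤ eLpNorm f (ENNReal.ofReal ν) (ENNReal.ofReal c • gaussMeasure ν) * H := by
          gcongr
          exact restrict_ball_le_gaussMeasure hν1 w
      _ = _ := by
          rw [eLpNorm_smul_measure_of_ne_top ENNReal.ofReal_ne_top, smul_eq_mul]
          congr 3
          simp [ENNReal.toReal_ofReal hν0.le]
  have hreal := ENNReal.toReal_mono (ENNReal.mul_ne_top (ENNReal.mul_ne_top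
    (ENNReal.rpow_lt_top_of_nonneg (by positivity) ENNReal.ofReal_ne_top).ne hfin) hHt) hmain
  rw [ENNReal.toReal_mul, ENNReal.toReal_mul, ENNReal.toReal_mul, ← norm_eq, toReal_enorm,
    ← ENNReal.toReal_rpow, ENNReal.toReal_ofReal hc0] at hreal
  have hcp : c ^ (1 / ν) = (2 * Real.pi / ν) ^ (1 / ν) * Real.exp ((‖w‖ + 1) ^ 2 / 2) := by
    rw [hc, Real.mul_rpow (by positivity) (Real.exp_pos _).le, ← Real.exp_mul]
    congr 2
    field_simp
  rw [hcp] at hreal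
  have hV0' : 0 < V.toReal := ENNReal.toReal_pos hV0 hVt
  have : ‖f w‖ ≤ ((2 * Real.pi / ν) ^ (1 / ν) * Real.exp ((‖w‖ + 1) ^ 2 / 2) * ‖f‖ * H.toReal)
      / V.toReal := by
    rw [le_div_iff₀ hV0']
    linarith
  refine this.trans_eq ?_
  ring

/-- Cauchy's estimate turns the bound on point evaluations into a local Lipschitz bound. -/
theorem exists_norm_sub_le (ν : ℝ) [hν : Fact (1 ≤ ν)] : ∃ K : ℝ, 0 ≤ K ∧
    ∀ (f : Fock ν) (R : ℝ) (w p : ℂ), ‖w‖ ≤ R → ‖p‖ ≤ R →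
      ‖f w - f p‖ ≤ K * Real.exp ((R + 2) ^ 2 / 2) * ‖f‖ * ‖w - p‖ := by
  obtain ⟨K, hK, h⟩ := exists_norm_apply_le ν
  refine ⟨K, hK, fun f R w p hw hp => ?_⟩
  refine (convex_closedBall (0 : ℂ) R).norm_image_sub_le_of_norm_deriv_le
    (fun x _ => f.differentiable x) (fun x hx => ?_)
    (by simpa using hp) (by simpa using hw)
  have hx' : ‖x‖ ≤ R := by simpa using hx
  have h1 := Complex.norm_deriv_le_of_forall_mem_sphere_norm_le (c := x) (R := 1)
    (C := K * Real.exp ((R + 2) ^ 2 / 2) * ‖f‖) one_pos f.differentiable.diffContOnCl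
    fun z hz => (h f z).trans (by
      have h2 : ‖z - x‖ = 1 := by simpa [dist_eq_norm] using hz
      have h3 := norm_sub_norm_le z x
      have h4 : ‖z‖ + 1 ≤ R + 2 := by linarith
      gcongr)
  simpa using h1

/-! ### Composition operators and test functions -/

/-- A composition map that is bounded for the Fock norm defines a composition operator. -/
theorem exists_isCompositionOperator {φ : ℂ → ℂ} (hφ : Differentiable ℂ φ) (M : ℝ)
    (h : ∀ f : Fock ν, Integrable (fun z => ‖f (φ z)‖ ^ ν * weight ν z) ∧
      fockNorm ν (fun z => f (φ z)) ≤ M * ‖f‖) :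
    ∃ C : Fock ν →L[ℂ] Fock ν, IsCompositionOperator φ C :=
  ⟨LinearMap.mkContinuous
    { toFun := fun f => ⟨fun z => f (φ z), f.differentiable.comp hφ, (h f).1⟩
      map_add' := fun _ _ => rfl
      map_smul' := fun _ _ => rfl } M fun f => (h f).2, fun _ _ => rfl⟩

theorem IsCompositionOperator.pow {φ : ℂ → ℂ} {C : Fock ν →L[ℂ] Fock ν}
    (hC : IsCompositionOperator φ C) (n : ℕ) (f : Fock ν) (z : ℂ) :
    (C ^ n) f z = f (φ^[n] z) := by
  induction n generalizing f z with
  | zero => simp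
  | succ n ih =>
    rw [pow_succ, mul_apply_eq_comp, ih, hC, Function.iterate_succ_apply']

/-- Functions of growth below `exp (|z|² / 2)`, as elements of the Fock space. -/
theorem exists_eq_of_growth {g : ℂ → ℂ} (hg : Differentiable ℂ g) {s M : ℝ} (hs : s < 1)
    (hM : 0 ≤ M) (h : ∀ z, ‖g z‖ ≤ M * Real.exp (s * ‖z‖ ^ 2 / 2)) :
    ∃ f : Fock ν, ∀ z, f z = g z := by
  obtain ⟨K, -, hK⟩ := fockNorm_le_of_growth hν.out hs
  exact ⟨⟨g, hg, (hK g M hg.continuous hM h).1⟩, fun _ => rfl⟩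

/-- The constant function `1` lies in the Fock space. -/
theorem exists_eq_one (ν : ℝ) [Fact (1 ≤ ν)] : ∃ e : Fock ν, ∀ z, e z = 1 :=
  exists_eq_of_growth (g := fun _ => 1) (s := 0) (M := 1) (differentiable_const _) one_pos
    zero_le_one (by simp)

/-- The coordinate function `z` lies in the Fock space. -/
theorem exists_eq_id (ν : ℝ) [Fact (1 ≤ ν)] : ∃ e : Fock ν, ∀ z, e z = z := by
  obtain ⟨s, A, hs, hA, h⟩ := exists_linear_mul_exp_le le_rfl one_pos 0
  refine exists_eq_of_growth (g := fun z => z) differentiable_id hs hA fun z => ?_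
  have := h ‖z‖ (norm_nonneg z)
  simp only [zero_mul, add_zero] at this
  norm_num at this
  linarith

/-! ### Rotations -/

theorem measurePreserving_const_mul {a : ℂ} (ha : ‖a‖ = 1) :
    MeasurePreserving (fun z : ℂ => a * z) volume volume :=
  (rotation (⟨a, mem_sphere_zero_iff_norm.2 ha⟩ : Circle)).measurePreserving

theorem measurableEmbedding_const_mul {a : ℂ} (ha : ‖a‖ = 1) :
    MeasurableEmbedding fun z : ℂ => a * z :=
  (rotation (⟨a, mem_sphere_zero_iff_norm.2 ha⟩ : Circle)).toHomeomorph.measurableEmbedding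

theorem integrable_rotation {a : ℂ} (ha : ‖a‖ = 1) (f : Fock ν) :
    Integrable fun z => ‖f (a * z)‖ ^ ν * weight ν z := by
  have h := ((measurePreserving_const_mul ha).integrable_comp_emb
    (measurableEmbedding_const_mul ha)).2 f.integrable
  refine h.congr (ae_of_all _ fun z => ?_)
  simp [weight, ha]

theorem fockNorm_rotation {a : ℂ} (ha : ‖a‖ = 1) (f : Fock ν) :
    fockNorm ν (fun z => f (a * z)) = ‖f‖ := by
  have h := (measurePreserving_const_mul ha).integral_comp (measurableEmbedding_const_mul ha)
    fun z => ‖f z‖ ^ ν * weight ν z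
  have h' : ∫ z, ‖f (a * z)‖ ^ ν * weight ν z = ∫ z, ‖f z‖ ^ ν * weight ν z := by
    rw [← h]
    congr 1
    ext z
    simp [weight, ha]
  change _ = fockNorm ν f
  rw [fockNorm, fockNorm, h']

theorem exists_isCompositionOperator_rotation (ν : ℝ) [Fact (1 ≤ ν)] {a : ℂ} (ha : ‖a‖ = 1) :
    ∃ C : Fock ν →L[ℂ] Fock ν, IsCompositionOperator (fun z => a * z) C :=
  exists_isCompositionOperator (differentiable_id.const_mul a) 1 fun f =>
    ⟨integrable_rotation ha f, by rw [fockNorm_rotation ha, one_mul]⟩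

theorem IsCompositionOperator.norm_rotation {a : ℂ} (ha : ‖a‖ = 1) {C : Fock ν →L[ℂ] Fock ν}
    (hC : IsCompositionOperator (fun z => a * z) C) (f : Fock ν) : ‖C f‖ = ‖f‖ := by
  rw [← fockNorm_rotation ha f]
  change fockNorm ν (C f) = _
  congr 1
  ext z
  exact hC f z

theorem IsCompositionOperator.surjective_rotation {a : ℂ} (ha : ‖a‖ = 1)
    {C : Fock ν →L[ℂ] Fock ν} (hC : IsCompositionOperator (fun z => a * z) C) :
    Function.Surjective C := by
  have ha0 : a ≠ 0 := by rintro rfl; simp at ha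
  obtain ⟨D, hD⟩ := exists_isCompositionOperator_rotation ν (a := a⁻¹) (by simp [ha])
  refine fun f => ⟨D f, Fock.ext fun z => ?_⟩
  rw [hC, hD]
  simp [ha0]

theorem IsCompositionOperator.inner_rotation {a : ℂ} (ha : ‖a‖ = 1)
    {C : Fock 2 →L[ℂ] Fock 2} (hC : IsCompositionOperator (fun z => a * z) C) (f g : Fock 2) :
    inner ℂ (C f) (C g) = inner ℂ f g := by
  rw [inner_def, inner_def, ← (measurePreserving_const_mul ha).integral_comp
    (measurableEmbedding_const_mul ha) fun z => conj (f z) * g z * (Real.exp (-‖z‖ ^ 2) : ℂ)]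
  congr 2
  ext z
  rw [hC, hC, norm_mul, ha, one_mul]

theorem IsCompositionOperator.pow_rotation {a : ℂ} {C : Fock ν →L[ℂ] Fock ν}
    (hC : IsCompositionOperator (fun z => a * z) C) (n : ℕ) :
    IsCompositionOperator (fun z => a ^ n * z) (C ^ n) := fun f z => by
  rw [hC.pow, mul_left_iterate]

/-- The powers of a nontrivial rotation do not converge weakly: the coordinate function is an
eigenvector with eigenvalue `a`, and `a ^ n` does not converge. -/
theorem IsCompositionOperator.not_weakly_convergent_rotation {a : ℂ} (ha : ‖a‖ = 1) (ha1 : a ≠ 1)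
    {C : Fock ν →L[ℂ] Fock ν} (hC : IsCompositionOperator (fun z => a * z) C) :
    ¬ ∃ P : Fock ν →L[ℂ] Fock ν, ∀ (f : Fock ν) (l : StrongDual ℂ (Fock ν)),
      Tendsto (fun n : ℕ => l ((C ^ n) f)) atTop (𝓝 (l (P f))) := by
  rintro ⟨P, hP⟩
  obtain ⟨e, he⟩ := exists_eq_id ν
  have he0 : e ≠ 0 := by
    rintro rfl
    have := he 1
    simp at this
  obtain ⟨l, -, hl⟩ := exists_dual_vector ℂ e (norm_ne_zero_iff.2 he0)
  have hl0 : l e ≠ 0 := by rw [hl]; simpa using he0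
  have heig : ∀ n : ℕ, (C ^ n) e = a ^ n • e := fun n => Fock.ext fun z => by
    rw [hC.pow_rotation n, he, coe_smul, Pi.smul_apply, he, smul_eq_mul]
  have h1 : Tendsto (fun n : ℕ => a ^ n) atTop (𝓝 (l (P e) / l e)) := by
    refine ((hP e l).div_const (l e)).congr fun n => ?_
    rw [heig, map_smul, smul_eq_mul, mul_div_cancel_right₀ _ hl0]
  have h2 : ‖l (P e) / l e‖ = 1 :=
    tendsto_nhds_unique h1.norm (by simp [ha])
  have h3 : Tendsto (fun n : ℕ => a ^ (n + 1)) atTop (𝓝 (a * (l (P e) / l e))) := by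
    simpa only [pow_succ'] using h1.const_mul a
  have h4 := tendsto_nhds_unique h3 (h1.comp (tendsto_add_atTop_nat 1))
  refine ha1 (mul_right_cancel₀ (b := l (P e) / l e) ?_ (by rw [h4, one_mul]))
  intro h0
  rw [h0, norm_zero] at h2
  exact zero_ne_one h2

/-! ### Affine contractions -/

/-- The bound on point evaluations, composed with an affine contraction, grows slower than
`exp (|z|² / 2)`, so that composition is bounded. -/
theorem exists_isCompositionOperator_affine (ν : ℝ) [hν : Fact (1 ≤ ν)] {a : ℂ} (ha : ‖a‖ < 1)
    (b : ℂ) : ∃ C : Fock ν →L[ℂ] Fock ν, IsCompositionOperator (fun z => a * z + b) C := by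
  obtain ⟨K, hK, hev⟩ := exists_norm_apply_le ν
  obtain ⟨s, A, hs, hA, hexp⟩ := exists_linear_mul_exp_le (norm_nonneg a) ha (‖b‖ + 1)
  obtain ⟨L, hL, hgrowth⟩ := fockNorm_le_of_growth hν.out hs
  have hφ : Differentiable ℂ fun z : ℂ => a * z + b := by fun_prop
  refine exists_isCompositionOperator hφ (L * (K * A)) fun f => ?_
  have := hgrowth (fun z => f (a * z + b)) (K * A * ‖f‖)
    (f.differentiable.comp hφ).continuous (by positivity) fun z => by
      have h1 : ‖a * z + b‖ + 1 ≤ ‖b‖ + 1 + ‖a‖ * ‖z‖ := by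
        have := norm_add_le (a * z) b
        rw [norm_mul] at this
        linarith
      have h2 : Real.exp ((‖a * z + b‖ + 1) ^ 2 / 2) ≤ A * Real.exp (s * ‖z‖ ^ 2 / 2) := by
        refine le_trans ?_ (hexp ‖z‖ (norm_nonneg z))
        refine le_trans ?_ (le_mul_of_one_le_left (Real.exp_pos _).le
          (by linarith [norm_nonneg z]))
        gcongr
      calc ‖f (a * z + b)‖ ≤ K * Real.exp ((‖a * z + b‖ + 1) ^ 2 / 2) * ‖f‖ := hev f _
        _ ≤ K * (A * Real.exp (s * ‖z‖ ^ 2 / 2)) * ‖f‖ := by gcongr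
        _ = _ := by ring
  exact ⟨this.1, this.2.trans_eq (by ring)⟩

/-- Evaluation at `p`, followed by the inclusion of the constants. -/
theorem exists_const_eval (ν : ℝ) [hν : Fact (1 ≤ ν)] (p : ℂ) :
    ∃ T : Fock ν →L[ℂ] Fock ν, (∀ (f : Fock ν) (z : ℂ), T f z = f p) ∧
      LinearMap.rank (T : Fock ν →ₗ[ℂ] Fock ν) = 1 := by
  obtain ⟨e, he⟩ := exists_eq_one ν
  obtain ⟨K, -, hev⟩ := exists_norm_apply_le ν
  let T : Fock ν →L[ℂ] Fock ν := (LinearMap.mkContinuous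
    { toFun := fun f : Fock ν => f p
      map_add' := fun _ _ => rfl
      map_smul' := fun _ _ => rfl } (K * Real.exp ((‖p‖ + 1) ^ 2 / 2))
      fun f => hev f p).smulRight e
  have hT : ∀ f : Fock ν, T f = f p • e := fun f => rfl
  refine ⟨T, fun f z => by rw [hT, coe_smul, Pi.smul_apply, he, smul_eq_mul, mul_one], ?_⟩
  have hTe : T e = e := by rw [hT, he, one_smul]
  refine rank_eq_one (⟨e, e, hTe⟩ : LinearMap.range (T : Fock ν →ₗ[ℂ] Fock ν)) ?_ ?_
  · intro h
    have h0 : e = 0 := congrArg Subtype.val h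
    have := he 0
    rw [h0] at this
    simp at this
  · rintro ⟨_, f, rfl⟩
    exact ⟨f p, Subtype.ext (hT f).symm⟩

theorem iterate_affine {a : ℂ} (ha : a ≠ 1) (b z : ℂ) (n : ℕ) :
    (fun z => a * z + b)^[n] z = b / (1 - a) + a ^ n * (z - b / (1 - a)) := by
  have h : 1 - a ≠ 0 := sub_ne_zero.2 ha.symm
  induction n with
  | zero => simp
  | succ n ih =>
    rw [Function.iterate_succ_apply', ih]
    field_simp
    ring

/-- The iterates of an affine contraction approach its fixed point geometrically, and so do the
powers of the composition operator approach the evaluation at the fixed point. -/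
theorem IsCompositionOperator.exists_norm_pow_sub_le {a b : ℂ} (ha : ‖a‖ < 1)
    {C T : Fock ν →L[ℂ] Fock ν} (hC : IsCompositionOperator (fun z => a * z + b) C)
    (hT : ∀ (f : Fock ν) (z : ℂ), T f z = f (b / (1 - a))) :
    ∃ M : ℝ, ∀ n : ℕ, 1 ≤ n → ‖C ^ n - T‖ ≤ M * ‖a‖ ^ n := by
  have ha1 : a ≠ 1 := by rintro rfl; simp at ha
  set p := b / (1 - a) with hp
  obtain ⟨K, hK, hlip⟩ := exists_norm_sub_le ν
  obtain ⟨s, A, hs, hA, hexp⟩ := exists_linear_mul_exp_le (norm_nonneg a) ha (2 * ‖p‖ + 2)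
  obtain ⟨L, hL, hgrowth⟩ := fockNorm_le_of_growth hν.out hs
  refine ⟨L * (K * (1 + ‖p‖) * A), fun n hn => ?_⟩
  refine ContinuousLinearMap.opNorm_le_bound _ (by positivity) fun f => ?_
  set g := (C ^ n - T) f with hg
  have hgz : ∀ z, g z = f (p + a ^ n * (z - p)) - f p := fun z => by
    have h1 : g z = (C ^ n) f z - T f z := rfl
    rw [h1, hC.pow, hT, iterate_affine ha1]
  -- for `1 ≤ n` all iterates contract at least as much as the first, so that one Gaussian
  -- dominates all the differences
  have han : ‖a‖ ^ n ≤ ‖a‖ := by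
    simpa using pow_le_pow_of_le_one (norm_nonneg a) ha.le hn
  have hbound : ∀ z, ‖g z‖ ≤ K * (1 + ‖p‖) * A * ‖a‖ ^ n * ‖f‖ * Real.exp (s * ‖z‖ ^ 2 / 2) := by
    intro z
    have hz := norm_nonneg z
    have hpn := norm_nonneg p
    have hsub : ‖a ^ n * (z - p)‖ ≤ ‖a‖ ^ n * (‖z‖ + ‖p‖) := by
      rw [norm_mul, norm_pow]
      gcongr
      exact norm_sub_le z p
    have hR : ‖p + a ^ n * (z - p)‖ ≤ 2 * ‖p‖ + ‖a‖ * ‖z‖ := by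
      have h1 := norm_add_le p (a ^ n * (z - p))
      have h2 : ‖a‖ ^ n * (‖z‖ + ‖p‖) ≤ ‖a‖ * (‖z‖ + ‖p‖) := by gcongr
      nlinarith
    have hpR : ‖p‖ ≤ 2 * ‖p‖ + ‖a‖ * ‖z‖ := by
      have := mul_nonneg (norm_nonneg a) hz
      linarith
    have h3 := hlip f _ _ _ hR hpR
    rw [← hgz, add_sub_cancel_left] at h3
    have h4 : ‖z‖ + ‖p‖ ≤ (1 + ‖p‖) * (1 + ‖z‖) := by nlinarith
    calc ‖g z‖ ≤ K * Real.exp ((2 * ‖p‖ + ‖a‖ * ‖z‖ + 2) ^ 2 / 2) * ‖f‖ *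
          (‖a‖ ^ n * ((1 + ‖p‖) * (1 + ‖z‖))) := by
          refine h3.trans ?_
          gcongr
          exact hsub.trans (by gcongr)
      _ = K * (1 + ‖p‖) * ‖a‖ ^ n * ‖f‖ *
          ((1 + ‖z‖) * Real.exp ((2 * ‖p‖ + 2 + ‖a‖ * ‖z‖) ^ 2 / 2)) := by
          rw [add_right_comm]
          ring
      _ ≤ K * (1 + ‖p‖) * ‖a‖ ^ n * ‖f‖ * (A * Real.exp (s * ‖z‖ ^ 2 / 2)) := by
          exact mul_le_mul_of_nonneg_left (hexp ‖z‖ hz) (by positivity)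
      _ = _ := by ring
  exact (hgrowth g _ g.differentiable.continuous (by positivity) hbound).2.trans_eq (by ring)

end Fock

theorem mainTheorem1 (ν : ℝ) [Fact (1 ≤ ν)] :
    (∀ a : ℂ, ‖a‖ = 1 → a ≠ 1 →
      (∃ C : Fock ν →L[ℂ] Fock ν, Fock.IsCompositionOperator (fun z => a * z) C ∧
        (∀ n : ℕ, Function.Surjective (C ^ n) ∧ ∀ f : Fock ν, ‖(C ^ n) f‖ = ‖f‖) ∧
        ¬ ∃ P : Fock ν →L[ℂ] Fock ν, ∀ (f : Fock ν) (l : StrongDual ℂ (Fock ν)),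
          Tendsto (fun n : ℕ => l ((C ^ n) f)) atTop (𝓝 (l (P f)))) ∧
      (∃ C : Fock 2 →L[ℂ] Fock 2, Fock.IsCompositionOperator (fun z => a * z) C ∧
        ∀ n : ℕ, Function.Surjective (C ^ n) ∧
          ∀ f g : Fock 2, inner ℂ ((C ^ n) f) ((C ^ n) g) = inner ℂ f g)) ∧
    (∀ a b : ℂ, ‖a‖ < 1 →
      ∃ C T : Fock ν →L[ℂ] Fock ν, Fock.IsCompositionOperator (fun z => a * z + b) C ∧
        (∀ (f : Fock ν) (z : ℂ), T f z = f (b / (1 - a))) ∧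
        LinearMap.rank (T : Fock ν →ₗ[ℂ] Fock ν) = 1 ∧
        Tendsto (fun n : ℕ => ‖C ^ n - T‖) atTop (𝓝 0)) := by
  refine ⟨fun a ha ha1 => ?_, fun a b ha => ?_⟩
  · have han : ∀ n : ℕ, ‖a ^ n‖ = 1 := fun n => by rw [norm_pow, ha, one_pow]
    refine ⟨?_, ?_⟩
    · obtain ⟨C, hC⟩ := Fock.exists_isCompositionOperator_rotation ν ha
      exact ⟨C, hC, fun n => ⟨(hC.pow_rotation n).surjective_rotation (han n),
        (hC.pow_rotation n).norm_rotation (han n)⟩, hC.not_weakly_convergent_rotation ha ha1⟩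
    · obtain ⟨C, hC⟩ := Fock.exists_isCompositionOperator_rotation 2 ha
      exact ⟨C, hC, fun n => ⟨(hC.pow_rotation n).surjective_rotation (han n),
        (hC.pow_rotation n).inner_rotation (han n)⟩⟩
  · obtain ⟨C, hC⟩ := Fock.exists_isCompositionOperator_affine ν ha b
    obtain ⟨T, hT, hrank⟩ := Fock.exists_const_eval ν (b / (1 - a))
    obtain ⟨M, hM⟩ := hC.exists_norm_pow_sub_le ha hT
    refine ⟨C, T, hC, hT, hrank, ?_⟩
    have h0 : Tendsto (fun n : ℕ => M * ‖a‖ ^ n) atTop (𝓝 0) := by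
      simpa using (tendsto_pow_atTop_nhds_zero_of_lt_one (norm_nonneg a) ha).const_mul M
    refine tendsto_of_tendsto_of_tendsto_of_le_of_le' tendsto_const_nhds h0
      (Eventually.of_forall fun n => norm_nonneg _) ?_
    filter_upwards [eventually_ge_atTop 1] with n hn using hM n hn
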